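/- Let $p$ be a prime and $n\ge 1$ an integer with $p^n>3$, and let $G=PSL(2,p^n)$ be the projective special linear group of degree $2$ over the finite field with $p^n$ elements. Let $\mathcal{P}^*(G)$ be the proper power graph of $G$, that is, the graph whose vertices are the non-identity elements of $G$, two distinct vertices being adjacent if and only if one of them is a power of the other. Then the number of connected components of $\mathcal{P}^*(G)$ is equal to $$\frac{p^{2n+1}-1}{p-1}.$$ -/

import Mathlib

/-- The power graph of a group: two distinct elements are adjacent if one of them is a power of
the other. -/
def powerGraph (G : Type*) [Group G] : SimpleGraph G where
  Adj x y := x ≠ y ∧ (x ∈ Subgroup.zpowers y ∨ y ∈ Subgroup.zpowers x)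
  symm := ⟨fun _ _ h => ⟨h.1.symm, h.2.symm⟩⟩
  loopless := ⟨fun _ h => h.1 rfl⟩

/-- The proper power graph of a group: the power graph with the identity element removed. -/
def properPowerGraph (G : Type*) [Group G] : SimpleGraph {x : G // x ≠ 1} :=
  (powerGraph G).induce {x : G | x ≠ 1}

/-! Let q = |F|. Modulo scalars, 2×2 matrices form F³, where a matrix has coordinates (a - d, b, c).
Passing from M to -M negates them, so a nontrivial element of PSL(2, F) has a well-defined
projective point. Powers of M lie in F + FM, so nontrivial powers keep this point. The discriminant
(a - d)² + 4bc separates two cases. Off the cone where it vanishes, F + FM is a separable quadratic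
algebra whose norm-one group is cyclic (`isCyclic_torus`), so elements with the same point are
connected. Every such point occurs because q > 3 (`exists_modScalar_eq_smul`), giving (q³ - q²)/(q -
1) = q² components. On the cone, the elements are the images of unipotents 1 + N with N² = 0. The q²
- 1 nontrivial ones have order p, and their components are the subgroups they generate, minus the
identity: (q² - 1)/(p - 1) of them. The sum is (pq² - 1)/(p - 1). -/

section Graph

/-! ### Reachability in power graphs and counting by invariants -/

variable {G : Type*} [Group G]

theorem properPowerGraph_reachable_of_mem_zpowers {x y : {x : G // x ≠ 1}}
    (h : x.1 ∈ Subgroup.zpowers y.1) : (properPowerGraph G).Reachable x y := by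
  by_cases hxy : x = y
  · rw [hxy]
  · exact SimpleGraph.Adj.reachable ⟨fun h' => hxy (Subtype.ext h'), Or.inl h⟩

theorem properPowerGraph_reachable_of_isCyclic {H : Subgroup G} [IsCyclic H]
    {x y : {x : G // x ≠ 1}} (hx : x.1 ∈ H) (hy : y.1 ∈ H) :
    (properPowerGraph G).Reachable x y := by
  obtain ⟨g, hg⟩ := IsCyclic.exists_generator (α := H)
  have key (z : {x : G // x ≠ 1}) (hz : z.1 ∈ H) : z.1 ∈ Subgroup.zpowers g.1 := by
    obtain ⟨k, hk⟩ := hg ⟨z.1, hz⟩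
    exact ⟨k, by simpa using congrArg Subtype.val hk⟩
  have hg1 : g.1 ≠ 1 := fun h => x.2 (by simpa [h] using key x hx)
  exact (properPowerGraph_reachable_of_mem_zpowers (y := ⟨g.1, hg1⟩) (key x hx)).trans
    (properPowerGraph_reachable_of_mem_zpowers (y := ⟨g.1, hg1⟩) (key y hy)).symm

theorem properPowerGraph_reachable_invariant {α : Type*} {f : {x : G // x ≠ 1} → α}
    (hf : ∀ x y, x.1 ∈ Subgroup.zpowers y.1 → f x = f y) {x y : {x : G // x ≠ 1}}
    (h : (properPowerGraph G).Reachable x y) : f x = f y := by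
  obtain ⟨w⟩ := h
  induction w with
  | nil => rfl
  | cons hadj _ ih =>
    refine Eq.trans ?_ ih
    rcases hadj.2 with h | h
    · exact hf _ _ h
    · exact (hf _ _ h).symm

theorem card_connectedComponent_eq_ncard_range {V α : Type*} {Γ : SimpleGraph V} {f : V → α}
    (hf : ∀ x y, Γ.Reachable x y ↔ f x = f y) :
    Nat.card Γ.ConnectedComponent = (Set.range f).ncard := by
  refine Nat.card_congr (Equiv.ofBijective (fun c => c.lift (fun v => (⟨f v, v, rfl⟩ : Set.range f))
    fun v w p _ => Subtype.ext ((hf v w).1 ⟨p⟩)) ⟨?_, ?_⟩)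
  · refine fun c d => SimpleGraph.ConnectedComponent.ind₂ (fun v w h => ?_) c d
    exact SimpleGraph.ConnectedComponent.sound ((hf v w).2 (congrArg Subtype.val h))
  · rintro ⟨_, v, rfl⟩
    exact ⟨Γ.connectedComponentMk v, rfl⟩

end Graph

theorem Set.ncard_eq_mul_ncard_image {α β : Type*} {s : Set α} (hs : s.Finite)
    (f : α → β) (m : ℕ) (hm : ∀ a ∈ s, {b ∈ s | f b = f a}.ncard = m) : s.ncard = m * (f '' s).ncard := by
  classical
  lift s to Finset α using hs
  have : f '' (s : Set α) = (s.image f : Finset β) := by simp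
  rw [this, Set.ncard_coe_finset, Set.ncard_coe_finset,
    Finset.card_eq_sum_card_image f s, Finset.sum_const_nat (m := m), mul_comm]
  intro b hb
  obtain ⟨a, ha, rfl⟩ := Finset.mem_image.1 hb
  rw [← hm a ha, ← Set.ncard_coe_finset]
  simp

/-! ### Matrices modulo scalars, the discriminant cone and tori -/

section Field

variable {F : Type*} [Field F]

/-- Membership in the quadric cone `x² + k y z = 0`. -/
def IsOnCone (k : F) (v : F × F × F) : Prop := v.1 ^ 2 + k * (v.2.1 * v.2.2) = 0

theorem isOnCone_smul_iff {k s : F} {v : F × F × F} (hs : s ≠ 0) :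
    IsOnCone k (s • v) ↔ IsOnCone k v := by
  have : (s • v).1 ^ 2 + k * ((s • v).2.1 * (s • v).2.2)
      = s ^ 2 * (v.1 ^ 2 + k * (v.2.1 * v.2.2)) := by
    simp only [Prod.smul_fst, Prod.smul_snd, smul_eq_mul]
    ring
  rw [IsOnCone, this, mul_eq_zero_iff_left (pow_ne_zero 2 hs), IsOnCone]

-- If k = 0 (as for k = 4 in characteristic 2) the cone is the plane x = 0. Otherwise y ≠ 0 lets x
-- determine z, while y = 0 forces x = 0 and leaves z free.
open Classical in
theorem ncard_isOnCone (k : F) : {v : F × F × F | IsOnCone k v}.ncard = Nat.card F ^ 2 := by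
  rw [← Nat.card_coe_set_eq, sq, ← Nat.card_prod]
  by_cases hk : k = 0
  · subst hk
    exact Nat.card_congr
      { toFun := fun v => v.1.2
        invFun := fun w => ⟨(0, w), by simp [IsOnCone]⟩
        left_inv := by
          rintro ⟨⟨x, y, z⟩, h⟩
          have : x = 0 := by simpa [IsOnCone] using h
          simp [this]
        right_inv := fun _ => rfl }
  · exact Nat.card_congr
      { toFun := fun v => (v.1.2.1, if v.1.2.1 = 0 then v.1.2.2 else v.1.1)
        invFun := fun w => ⟨if w.1 = 0 then (0, 0, w.2) else (w.2, w.1, -w.2 ^ 2 / (k * w.1)), by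
          by_cases hw : w.1 = 0
          · simp [IsOnCone, hw]
          · simp only [IsOnCone, hw, if_false, Set.mem_ofPred_eq]
            field_simp
            ring⟩
        left_inv := by
          rintro ⟨⟨x, y, z⟩, h⟩
          replace h : x ^ 2 + k * (y * z) = 0 := h
          by_cases hy : y = 0
          · have : x = 0 := by simpa [hy] using h
            simp [hy, this]
          · have : -x ^ 2 / (k * y) = z := by
              field_simp
              linear_combination -h
            simp [hy, this]
        right_inv := by
          rintro ⟨y, w⟩
          by_cases hy : y = 0 <;> simp [hy] }

/-- The class of a matrix modulo scalar matrices. -/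
def modScalar (M : Matrix.SpecialLinearGroup (Fin 2) F) : F × F × F :=
  (M 0 0 - M 1 1, M 0 1, M 1 0)

theorem SL2_det (M : Matrix.SpecialLinearGroup (Fin 2) F) : M 0 0 * M 1 1 - M 0 1 * M 1 0 = 1 := by
  rw [← Matrix.det_fin_two]; exact M.2

theorem SL2_ext {M N : Matrix.SpecialLinearGroup (Fin 2) F} (h : modScalar M = modScalar N)
    (h1 : M 1 1 = N 1 1) : M = N := by
  simp only [modScalar, Prod.mk.injEq] at h
  ext i j
  fin_cases i <;> fin_cases j
  · change M 0 0 = N 0 0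
    linear_combination h.1 + h1
  · exact h.2.1
  · exact h.2.2
  · exact h1

theorem modScalar_neg (M : Matrix.SpecialLinearGroup (Fin 2) F) :
    modScalar (-M) = -modScalar M := by
  simp [modScalar]; ring

theorem modScalar_inv (M : Matrix.SpecialLinearGroup (Fin 2) F) :
    modScalar M⁻¹ = -modScalar M := by
  simp [modScalar, Matrix.SpecialLinearGroup.SL2_inv_expl]

theorem modScalar_one : modScalar (1 : Matrix.SpecialLinearGroup (Fin 2) F) = 0 := by
  simp [modScalar]

theorem SL2_mul_apply (M N : Matrix.SpecialLinearGroup (Fin 2) F) (i j : Fin 2) :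
    (M * N) i j = M i 0 * N 0 j + M i 1 * N 1 j := by
  rw [← Fin.sum_univ_two fun k => M i k * N k j]
  exact Matrix.mul_apply

/-- With V = !![v1, v2; v3, 0], M = M 1 1 + sV and N = N 1 1 + tV. Since V² = v1 V + v2 v3, the
scalar is the coefficient of V in the product. -/
theorem modScalar_mul {v : F × F × F} {s t : F} {M N : Matrix.SpecialLinearGroup (Fin 2) F}
    (hM : modScalar M = s • v) (hN : modScalar N = t • v) :
    modScalar (M * N) = (M 1 1 * t + N 1 1 * s + s * t * v.1) • v := by
  obtain ⟨v1, v2, v3⟩ := v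
  simp only [modScalar, Prod.smul_mk, Prod.mk.injEq, smul_eq_mul, SL2_mul_apply] at hM hN ⊢
  obtain ⟨h1, h2, h3⟩ := hM
  obtain ⟨k1, k2, k3⟩ := hN
  have h0 : M 0 0 = M 1 1 + s * v1 := by linear_combination h1
  have k0 : N 0 0 = N 1 1 + t * v1 := by linear_combination k1
  rw [h0, k0, h2, h3, k2, k3]
  refine ⟨by ring, by ring, by ring⟩

/-- The matrices of determinant one that lie in the algebra spanned by the scalars and by a matrix
with given class modulo scalars. -/
def torus (v : F × F × F) : Subgroup (Matrix.SpecialLinearGroup (Fin 2) F) where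
  carrier := {M | ∃ s : F, modScalar M = s • v}
  one_mem' := ⟨0, by simp [modScalar_one]⟩
  mul_mem' := by
    rintro M N ⟨s, hs⟩ ⟨t, ht⟩
    exact ⟨_, modScalar_mul hs ht⟩
  inv_mem' := by
    rintro M ⟨s, hs⟩
    exact ⟨-s, by rw [modScalar_inv, hs, neg_smul]⟩

theorem mk_eq_mk_iff {M N : Matrix.SpecialLinearGroup (Fin 2) F} :
    (M : Matrix.ProjectiveSpecialLinearGroup (Fin 2) F) = N ↔ N = M ∨ N = -M := by
  rw [QuotientGroup.eq, Matrix.SpecialLinearGroup.mem_center_iff]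
  constructor
  · rintro ⟨r, hr, h⟩
    rw [Fintype.card_fin, sq_eq_one_iff] at hr
    rcases hr with rfl | rfl
    · left
      have : M⁻¹ * N = 1 := by
        apply Subtype.ext
        rw [← h]; simp
      exact (inv_mul_eq_one.1 this).symm
    · right
      have : M⁻¹ * N = -1 := by
        apply Subtype.ext
        rw [← h]; ext i j; fin_cases i <;> fin_cases j <;> simp
      rw [inv_mul_eq_iff_eq_mul.1 this, mul_neg, mul_one]
  · rintro (rfl | rfl)
    · exact ⟨1, by simp, by simp⟩
    · refine ⟨-1, by simp, ?_⟩
      rw [mul_neg, inv_mul_cancel]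
      ext i j; fin_cases i <;> fin_cases j <;> simp

theorem mk_eq_one_iff {M : Matrix.SpecialLinearGroup (Fin 2) F} :
    (M : Matrix.ProjectiveSpecialLinearGroup (Fin 2) F) = 1 ↔ modScalar M = 0 := by
  rw [← QuotientGroup.mk_one, eq_comm, mk_eq_mk_iff]
  constructor
  · rintro (rfl | rfl) <;> simp [modScalar_neg, modScalar_one]
  · intro h
    have hd := SL2_det M
    have h' := h
    simp only [modScalar, Prod.mk_eq_zero] at h'
    have : (M 1 1) ^ 2 = 1 := by
      rw [h'.2.1] at hd
      linear_combination hd - M 1 1 * h'.1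
    rcases sq_eq_one_iff.1 this with h1 | h1
    · exact Or.inl (SL2_ext (by rw [h, modScalar_one]) (by simp [h1]))
    · exact Or.inr (SL2_ext (by rw [h, modScalar_neg, modScalar_one, neg_zero]) (by simp [h1]))

/-- Sending V to one of its eigenvalues r embeds this finite group in the multiplicative monoid of a
field. -/
theorem isCyclic_torus [Finite F] {v : F × F × F} (hv : ¬ IsOnCone 4 v) :
    IsCyclic (torus v) := by
  have hv0 : v ≠ 0 := by rintro rfl; simp [IsOnCone] at hv
  -- `L` reads off the coefficient s of V linearly.
  obtain ⟨L, hL⟩ : ∃ L : (F × F × F) →ₗ[F] F, L v = 1 := by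
    obtain ⟨L, hL⟩ := Module.Projective.exists_dual_ne_zero F hv0
    exact ⟨(L v)⁻¹ • L, by simp [hL]⟩
  have hLM (M : torus v) : modScalar M.1 = L (modScalar M.1) • v := by
    obtain ⟨s, hs⟩ := M.2
    rw [hs]; simp [hL]
  let K := AlgebraicClosure F
  let e := algebraMap F K
  obtain ⟨r, hr⟩ : ∃ r : K, r ^ 2 - e v.1 * r - e (v.2.1 * v.2.2) = 0 := by
    obtain ⟨r, hr⟩ := IsAlgClosed.exists_root
      (Polynomial.C 1 * Polynomial.X ^ 2 + Polynomial.C (-e v.1) * Polynomial.X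
        + Polynomial.C (-e (v.2.1 * v.2.2)))
      (by rw [Polynomial.degree_quadratic one_ne_zero]; decide)
    refine ⟨r, ?_⟩
    simp only [Polynomial.IsRoot, Polynomial.eval_add, Polynomial.eval_mul, Polynomial.eval_C,
      Polynomial.eval_pow, Polynomial.eval_X] at hr
    linear_combination hr
  have hdet (M : torus v) : M.1 1 1 ^ 2 + L (modScalar M.1) * v.1 * M.1 1 1
      - L (modScalar M.1) ^ 2 * (v.2.1 * v.2.2) = 1 := by
    have hd := SL2_det M.1
    have h := hLM M
    set s := L (modScalar M.1)
    have h1 : M.1 0 0 - M.1 1 1 = s * v.1 := congrArg (·.1) h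
    have h2 : M.1 0 1 = s * v.2.1 := congrArg (·.2.1) h
    have h3 : M.1 1 0 = s * v.2.2 := congrArg (·.2.2) h
    rw [h2, h3] at hd
    linear_combination hd - M.1 1 1 * h1
  let f : torus v →* K :=
    { toFun := fun M => e (M.1 1 1) + e (L (modScalar M.1)) * r
      map_one' := by simp [modScalar_one]
      map_mul' := fun M N => by
        have hMN := modScalar_mul (hLM M) (hLM N)
        have h11 : (M * N).1 1 1 = L (modScalar M.1) * L (modScalar N.1) * (v.2.1 * v.2.2)
            + M.1 1 1 * N.1 1 1 := by
          have h3 : M.1 1 0 = L (modScalar M.1) * v.2.2 := congrArg (·.2.2) (hLM M)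
          have h2 : N.1 0 1 = L (modScalar N.1) * v.2.1 := congrArg (·.2.1) (hLM N)
          rw [Subgroup.coe_mul, SL2_mul_apply, h3, h2]
          ring
        have hs : L (modScalar (M * N).1) = M.1 1 1 * L (modScalar N.1)
            + N.1 1 1 * L (modScalar M.1) + L (modScalar M.1) * L (modScalar N.1) * v.1 := by
          rw [Subgroup.coe_mul, hMN]; simp [hL]
        rw [h11, hs]
        simp only [map_add, map_mul] at hr ⊢
        linear_combination (-(e (L (modScalar M.1)) * e (L (modScalar N.1)))) * hr }
  refine isCyclic_of_injective_ringHom f ((injective_iff_map_eq_one f).2 fun M hM => ?_)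
  replace hM : e (M.1 1 1) + e (L (modScalar M.1)) * r = 1 := hM
  have hd := congrArg e (hdet M)
  have hv' : (e v.1) ^ 2 + 4 * e (v.2.1 * v.2.2) ≠ 0 := by
    intro h
    refine hv (e.injective ?_)
    simpa [show e 4 = 4 from map_ofNat e 4] using h
  set s := L (modScalar M.1) with hs
  simp only [map_sub, map_add, map_mul, map_pow, map_one] at hd hr hv'
  -- The determinant is the product of the values at r and at the other root v1 - r. If the first is
  -- 1, so is the second, and s (v1 - 2r) = 0, where (v1 - 2r)² is the nonzero discriminant.
  have hs0 : s = 0 := by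
    have h2 : (e s * (e v.1 - 2 * r)) = 0 := by
      linear_combination hd - (e (M.1 1 1) + e s * e v.1 - e s * r + 1) * hM - e s ^ 2 * hr
    rcases mul_eq_zero.1 h2 with h | h
    · exact (map_eq_zero e).1 h
    · exact absurd (by linear_combination (e v.1 - 2 * r) * h - 4 * hr) hv'
  refine Subtype.ext (SL2_ext ?_ ?_)
  · rw [hLM M, ← hs, hs0, zero_smul, OneMemClass.coe_one, modScalar_one]
  · have : e (M.1 1 1) = e 1 := by simpa [hs0] using hM
    simpa using e.injective this

/-- For A = m + V, det(1 + sA) = 1 + s tr A + s² det A, so s = -tr A / det A works once both are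
nonzero. This excludes at most three values of m, whence 3 < |F|. -/
theorem exists_modScalar_eq_smul [Finite F] (hF : 3 < Nat.card F) {v : F × F × F}
    (hv : ¬ IsOnCone 4 v) :
    ∃ (s : F) (M : Matrix.SpecialLinearGroup (Fin 2) F), s ≠ 0 ∧ modScalar M = s • v := by
  obtain ⟨t, b, c⟩ := v
  obtain ⟨m, hm⟩ : ∃ m : F, (m ^ 2 + t * m - b * c) * (2 * m + t) ≠ 0 := by
    have h1 : (Polynomial.C 1 * Polynomial.X ^ 2 + Polynomial.C t * Polynomial.X
        + Polynomial.C (-(b * c)) : Polynomial F) ≠ 0 :=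
      Polynomial.ne_zero_of_degree_gt (n := 1)
        (by rw [Polynomial.degree_quadratic one_ne_zero]; decide)
    -- If 2 = 0 and t = 0, the vector would lie on the cone.
    have h2 : (Polynomial.C 2 * Polynomial.X + Polynomial.C t : Polynomial F) ≠ 0 := by
      intro h
      have h0 := congrArg (Polynomial.coeff · 0) h
      have h1 := congrArg (Polynomial.coeff · 1) h
      simp at h0 h1
      refine hv ?_
      simp only [IsOnCone]
      linear_combination t * h0 + 2 * b * c * h1
    obtain ⟨m, hm⟩ := Polynomial.exists_eval_ne_zero_of_natDegree_lt_card _ (mul_ne_zero h1 h2)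
      (by
        rw [← Nat.cast_card]
        refine lt_of_le_of_lt (Nat.cast_le.2 (Polynomial.natDegree_mul_le.trans
          (add_le_add Polynomial.natDegree_quadratic_le Polynomial.natDegree_linear_le))) ?_
        exact_mod_cast hF)
    refine ⟨m, fun h => hm ?_⟩
    simp
    simp at h
    rcases h with h | h
    · left; linear_combination h
    · right; exact h
  have hd := left_ne_zero_of_mul hm
  have hn := right_ne_zero_of_mul hm
  refine ⟨-(2 * m + t) / (m ^ 2 + t * m - b * c), ?_⟩
  set s := -(2 * m + t) / (m ^ 2 + t * m - b * c) with hs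
  have hsd : s * (m ^ 2 + t * m - b * c) = -(2 * m + t) := div_mul_cancel₀ _ hd
  refine ⟨⟨!![1 + m * s + s * t, s * b; s * c, 1 + m * s], ?_⟩, ?_, ?_⟩
  · rw [Matrix.det_fin_two_of]
    linear_combination s * hsd
  · rw [hs]; exact div_ne_zero (neg_ne_zero.2 hn) hd
  · simp [modScalar]

end Field
-- Projective points and unipotent elements in PSL(2, F)
section PSL

variable {F : Type*} [Field F]

/-- The projective point of the class modulo scalars of an element of `PSL(2, F)`. -/
def modScalarSpan (g : Matrix.ProjectiveSpecialLinearGroup (Fin 2) F) :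
    Submodule F (F × F × F) :=
  Submodule.span F {modScalar g.out}

/-- The element is represented by matrices with a double eigenvalue. -/
def IsDegenerate (g : Matrix.ProjectiveSpecialLinearGroup (Fin 2) F) : Prop :=
  IsOnCone 4 (modScalar g.out)

theorem modScalar_out_mk (M : Matrix.SpecialLinearGroup (Fin 2) F) :
    ∃ s : F, s ≠ 0 ∧ modScalar (M : Matrix.ProjectiveSpecialLinearGroup (Fin 2) F).out
      = s • modScalar M := by
  rcases mk_eq_mk_iff.1 (QuotientGroup.out_eq' (M : Matrix.ProjectiveSpecialLinearGroup (Fin 2) F))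
    with h | h
  · exact ⟨1, one_ne_zero, by rw [one_smul]; exact congrArg modScalar h.symm⟩
  · refine ⟨-1, by simp, ?_⟩
    rw [neg_smul, one_smul]
    conv_rhs => rw [h, modScalar_neg, neg_neg]

theorem modScalarSpan_mk (M : Matrix.SpecialLinearGroup (Fin 2) F) :
    modScalarSpan (M : Matrix.ProjectiveSpecialLinearGroup (Fin 2) F)
      = Submodule.span F {modScalar M} := by
  obtain ⟨s, hs, h⟩ := modScalar_out_mk M
  rw [modScalarSpan, h, Submodule.span_singleton_smul_eq hs.isUnit]

theorem isDegenerate_mk {M : Matrix.SpecialLinearGroup (Fin 2) F} :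
    IsDegenerate (M : Matrix.ProjectiveSpecialLinearGroup (Fin 2) F)
      ↔ IsOnCone 4 (modScalar M) := by
  obtain ⟨s, hs, h⟩ := modScalar_out_mk M
  rw [IsDegenerate, h, isOnCone_smul_iff hs]

theorem exists_modScalar_eq_smul_of_mem_zpowers
    {g h : Matrix.ProjectiveSpecialLinearGroup (Fin 2) F} (hg : g ≠ 1)
    (hgh : g ∈ Subgroup.zpowers h) :
    ∃ (M N : Matrix.SpecialLinearGroup (Fin 2) F) (s : F),
      (M : Matrix.ProjectiveSpecialLinearGroup (Fin 2) F) = g ∧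
      (N : Matrix.ProjectiveSpecialLinearGroup (Fin 2) F) = h ∧
      s ≠ 0 ∧ modScalar M = s • modScalar N := by
  obtain ⟨N, rfl⟩ := QuotientGroup.mk_surjective h
  obtain ⟨k, rfl⟩ := hgh
  have hN : N ∈ torus (modScalar N) := ⟨1, by simp⟩
  obtain ⟨s, hs⟩ := (torus (modScalar N)).zpow_mem hN k
  refine ⟨N ^ k, N, s, by simp, rfl, ?_, hs⟩
  rintro rfl
  refine hg ?_
  simp only
  rw [← QuotientGroup.mk_zpow, mk_eq_one_iff, hs, zero_smul]

/-- The unipotent matrix `1 + N`, where `N` is the nilpotent matrix with given entries. -/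
def unipotent (v : F × F × F) (h : IsOnCone 1 v) : Matrix.SpecialLinearGroup (Fin 2) F :=
  ⟨!![1 + v.1, v.2.1; v.2.2, 1 - v.1], by
    rw [Matrix.det_fin_two_of]
    unfold IsOnCone at h
    linear_combination -h⟩

theorem modScalar_unipotent (v : F × F × F) (h : IsOnCone 1 v) :
    modScalar (unipotent v h) = (2 * v.1, v.2.1, v.2.2) := by
  simp [modScalar, unipotent]; ring

theorem isDegenerate_unipotent (v : F × F × F) (h : IsOnCone 1 v) :
    IsDegenerate (unipotent v h : Matrix.ProjectiveSpecialLinearGroup (Fin 2) F) := by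
  rw [isDegenerate_mk, modScalar_unipotent]
  unfold IsOnCone at *
  linear_combination 4 * h

theorem unipotent_mk_injective {v w : F × F × F} {hv : IsOnCone 1 v} {hw : IsOnCone 1 w}
    (h : (unipotent v hv : Matrix.ProjectiveSpecialLinearGroup (Fin 2) F) = unipotent w hw) :
    v = w := by
  have ext_iff (h : ∀ i j, unipotent w hw i j = unipotent v hv i j) : v = w := by
    have h00 := h 0 0
    have h01 := h 0 1
    have h10 := h 1 0
    simp [unipotent] at h00 h01 h10
    exact Prod.ext h00.symm (Prod.ext h01.symm h10.symm)
  rcases mk_eq_mk_iff.1 h with h | h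
  · exact ext_iff fun i j => by rw [h]
  · have h' (i j) : unipotent w hw i j = -unipotent v hv i j := by rw [h]; rfl
    have h00 := h' 0 0
    have h11 := h' 1 1
    simp [unipotent] at h00 h11
    -- Comparing traces gives 2 = -2, hence characteristic 2, where the sign is immaterial.
    have h2 : (2 : F) * 2 = 0 := by linear_combination h00 + h11
    have h2 : (2 : F) = 0 := mul_self_eq_zero.1 h2
    refine ext_iff fun i j => ?_
    linear_combination h' i j - h2 * unipotent v hv i j

/-- The discriminant equals tr² - 4, so the trace is 2 up to the choice of sign of the
representative. -/
theorem IsDegenerate.exists_unipotent {g : Matrix.ProjectiveSpecialLinearGroup (Fin 2) F}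
    (hg : IsDegenerate g) : ∃ (v : F × F × F) (h : IsOnCone 1 v),
      (unipotent v h : Matrix.ProjectiveSpecialLinearGroup (Fin 2) F) = g := by
  have key (M : Matrix.SpecialLinearGroup (Fin 2) F) (hM : M 0 0 + M 1 1 = 2) :
      ∃ (v : F × F × F) (h : IsOnCone 1 v), unipotent v h = M := by
    have hd := SL2_det M
    refine ⟨(M 0 0 - 1, M 0 1, M 1 0), ?_, ?_⟩
    · simp only [IsOnCone]
      linear_combination M 0 0 * hM - hd
    · refine SL2_ext ?_ ?_
      · rw [modScalar_unipotent]
        simp only [modScalar, Prod.mk.injEq, and_true]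
        linear_combination hM
      · simp [unipotent]
        linear_combination -hM
  obtain ⟨M, rfl⟩ := QuotientGroup.mk_surjective g
  rw [isDegenerate_mk] at hg
  have hd := SL2_det M
  have h4 : (M 0 0 + M 1 1 - 2) * (M 0 0 + M 1 1 + 2) = 0 := by
    simp only [IsOnCone, modScalar] at hg
    linear_combination hg + 4 * hd
  rcases mul_eq_zero.1 h4 with h | h
  · obtain ⟨v, hv, e⟩ := key M (by linear_combination h)
    exact ⟨v, hv, by rw [e]⟩
  · obtain ⟨v, hv, e⟩ := key (-M) (by
      change -M 0 0 + -M 1 1 = 2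
      linear_combination -h)
    exact ⟨v, hv, by rw [e, mk_eq_mk_iff]; simp⟩

/-- N² = 0 gives (1 + N)^k = 1 + kN. -/
theorem unipotent_pow (v : F × F × F) (h : IsOnCone 1 v) (k : ℕ) :
    ∃ h', unipotent v h ^ k = unipotent ((k : F) • v) h' := by
  have h' : IsOnCone 1 ((k : F) • v) := by
    simp only [IsOnCone, Prod.smul_fst, Prod.smul_snd, smul_eq_mul] at h ⊢
    linear_combination (k : F) ^ 2 * h
  refine ⟨h', ?_⟩
  induction k with
  | zero =>
    rw [pow_zero]
    ext i j
    fin_cases i <;> fin_cases j <;> simp [unipotent]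
  | succ k ih =>
    have h'' : IsOnCone 1 ((k : F) • v) := by
      simp only [IsOnCone, Prod.smul_fst, Prod.smul_snd, smul_eq_mul] at h ⊢
      linear_combination (k : F) ^ 2 * h
    rw [pow_succ, ih h'']
    unfold IsOnCone at h
    have e (i j) : (unipotent ((k : F) • v) h'' * unipotent v ‹_›) i j
        = unipotent (((k + 1 : ℕ) : F) • v) h' i j := by
      rw [SL2_mul_apply]
      fin_cases i <;> fin_cases j <;> simp [unipotent]
      · linear_combination (k : F) * h
      · ring
      · ring
      · linear_combination (k : F) * h
    exact Matrix.SpecialLinearGroup.ext _ _ e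

theorem IsDegenerate.orderOf_eq {p : ℕ} [hp : Fact p.Prime] [CharP F p]
    {g : Matrix.ProjectiveSpecialLinearGroup (Fin 2) F} (hg : IsDegenerate g) (hg1 : g ≠ 1) :
    orderOf g = p := by
  refine orderOf_eq_prime ?_ hg1
  obtain ⟨v, h, rfl⟩ := hg.exists_unipotent
  obtain ⟨h', e⟩ := unipotent_pow v h p
  rw [← QuotientGroup.mk_pow, e, mk_eq_one_iff, modScalar_unipotent]
  simp

theorem isDegenerate_one :
    IsDegenerate (1 : Matrix.ProjectiveSpecialLinearGroup (Fin 2) F) := by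
  rw [← QuotientGroup.mk_one, isDegenerate_mk, modScalar_one]
  simp [IsOnCone]

theorem ncard_isDegenerate [Finite F] :
    {g : Matrix.ProjectiveSpecialLinearGroup (Fin 2) F | IsDegenerate g ∧ g ≠ 1}.ncard
      = Nat.card F ^ 2 - 1 := by
  have h : {g : Matrix.ProjectiveSpecialLinearGroup (Fin 2) F | IsDegenerate g}.ncard
      = Nat.card F ^ 2 := by
    rw [← ncard_isOnCone 1, ← Nat.card_coe_set_eq, ← Nat.card_coe_set_eq]
    refine (Nat.card_congr (Equiv.ofBijective
      (fun v => ⟨(unipotent v.1 v.2 : Matrix.ProjectiveSpecialLinearGroup (Fin 2) F),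
        isDegenerate_unipotent v.1 v.2⟩) ⟨?_, ?_⟩)).symm
    · intro v w h
      exact Subtype.ext (unipotent_mk_injective (congrArg Subtype.val h))
    · rintro ⟨g, hg⟩
      obtain ⟨v, hv, e⟩ := IsDegenerate.exists_unipotent hg
      exact ⟨⟨v, hv⟩, Subtype.ext e⟩
  rw [← h, ← Set.ncard_sdiff_singleton_of_mem (a := 1) isDegenerate_one]
  congr 1

/-! ### The invariant that separates components -/

open Classical in
/-- The complete invariant of connected components of the proper power graph of `PSL(2, F)`. -/
noncomputable def componentInvariant
    (g : {g : Matrix.ProjectiveSpecialLinearGroup (Fin 2) F // g ≠ 1}) :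
    Submodule F (F × F × F) ⊕ Subgroup (Matrix.ProjectiveSpecialLinearGroup (Fin 2) F) :=
  if IsDegenerate g.1 then Sum.inr (Subgroup.zpowers g.1) else Sum.inl (modScalarSpan g.1)

theorem zpowers_eq_of_mem_of_prime {G : Type*} [Group G] {g h : G} (hg : g ≠ 1)
    (hp : (orderOf h).Prime) (hgh : g ∈ Subgroup.zpowers h) :
    Subgroup.zpowers g = Subgroup.zpowers h := by
  have := Fact.mk hp
  have : Finite (Subgroup.zpowers h) :=
    Nat.finite_of_card_ne_zero (by rw [Nat.card_zpowers]; exact hp.ne_zero)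
  refine Subgroup.eq_of_le_of_card_ge (Subgroup.zpowers_le.2 hgh) ?_
  rw [Nat.card_zpowers, Nat.card_zpowers, orderOf_eq_prime (x := g) (p := orderOf h) ?_ hg]
  obtain ⟨k, rfl⟩ := hgh
  simp only
  rw [← zpow_natCast, zpow_comm, zpow_natCast, pow_orderOf_eq_one, one_zpow]

theorem reachable_iff_componentInvariant_eq [Finite F]
    {g h : {g : Matrix.ProjectiveSpecialLinearGroup (Fin 2) F // g ≠ 1}} :
    (properPowerGraph (Matrix.ProjectiveSpecialLinearGroup (Fin 2) F)).Reachable g h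
      ↔ componentInvariant g = componentInvariant h := by
  constructor
  · refine properPowerGraph_reachable_invariant fun x y hxy => ?_
    obtain ⟨M, N, s, hM, hN, hs, e⟩ := exists_modScalar_eq_smul_of_mem_zpowers x.2 hxy
    have hd : IsDegenerate x.1 ↔ IsDegenerate y.1 := by
      rw [← hM, ← hN, isDegenerate_mk, isDegenerate_mk, e, isOnCone_smul_iff hs]
    by_cases hy : IsDegenerate y.1
    · obtain ⟨p, _⟩ := CharP.exists F
      have := Fact.mk (CharP.char_is_prime F p)
      rw [componentInvariant, componentInvariant, if_pos hy, if_pos (hd.2 hy),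
        zpowers_eq_of_mem_of_prime x.2 (by rw [hy.orderOf_eq (p := p) y.2]; exact this.out) hxy]
    · rw [componentInvariant, componentInvariant, if_neg hy, if_neg (mt hd.1 hy), ← hM, ← hN,
        modScalarSpan_mk, modScalarSpan_mk, e, Submodule.span_singleton_smul_eq hs.isUnit]
  · intro e
    unfold componentInvariant at e
    split_ifs at e with hg hh hh
    · exact properPowerGraph_reachable_of_mem_zpowers
        (Sum.inr_injective e ▸ Subgroup.mem_zpowers g.1)
    · replace e := Sum.inl_injective e
      -- Both elements lie in the image of a single torus, which is again cyclic.
      have hC := isCyclic_torus (v := modScalar h.1.out) hh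
      have := isCyclic_of_surjective ((QuotientGroup.mk' (Subgroup.center _)).subgroupMap
        (torus (modScalar h.1.out))) (MonoidHom.subgroupMap_surjective _ _)
      refine properPowerGraph_reachable_of_isCyclic (H := (torus (modScalar h.1.out)).map
        (QuotientGroup.mk' (Subgroup.center _))) ⟨g.1.out, ?_, QuotientGroup.out_eq' _⟩
        ⟨h.1.out, ⟨1, by simp⟩, QuotientGroup.out_eq' _⟩
      obtain ⟨s, hs⟩ := Submodule.mem_span_singleton.1
        (e ▸ Submodule.mem_span_singleton_self (modScalar g.1.out) :
          modScalar g.1.out ∈ modScalarSpan h.1)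
      exact ⟨s, hs.symm⟩

/-! ### Counting the values of the invariant -/

theorem ncard_zpowers_isDegenerate [Finite F] (p : ℕ) [hp : Fact p.Prime] [CharP F p] :
    (p - 1) * (Subgroup.zpowers '' {g : Matrix.ProjectiveSpecialLinearGroup (Fin 2) F |
      IsDegenerate g ∧ g ≠ 1}).ncard = Nat.card F ^ 2 - 1 := by
  rw [← ncard_isDegenerate, eq_comm]
  refine Set.ncard_eq_mul_ncard_image (Set.toFinite _) _ _ ?_
  rintro g ⟨hg, hg1⟩
  have hgp := hg.orderOf_eq (p := p) hg1
  -- Every nontrivial element of a degenerate cyclic subgroup is degenerate and generates it, so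
  -- each fibre has p - 1 elements.
  have : {b ∈ {g : Matrix.ProjectiveSpecialLinearGroup (Fin 2) F | IsDegenerate g ∧ g ≠ 1} |
      Subgroup.zpowers b = Subgroup.zpowers g} = (Subgroup.zpowers g : Set _) \ {1} := by
    ext b
    constructor
    · rintro ⟨⟨_, hb1⟩, hb⟩
      exact ⟨hb ▸ Subgroup.mem_zpowers b, hb1⟩
    · rintro ⟨hb, hb1⟩
      obtain ⟨M, N, s, hM, hN, hs, e⟩ := exists_modScalar_eq_smul_of_mem_zpowers hb1 hb
      refine ⟨⟨?_, hb1⟩, zpowers_eq_of_mem_of_prime hb1 (hgp ▸ hp.out) hb⟩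
      rwa [← hM, isDegenerate_mk, e, isOnCone_smul_iff hs, ← isDegenerate_mk, hN]
  rw [this, Set.ncard_sdiff_singleton_of_mem (one_mem _), ← Nat.card_coe_set_eq]
  change Nat.card (Subgroup.zpowers g) - 1 = _
  rw [Nat.card_zpowers, hgp]

theorem ncard_span_not_isOnCone [Finite F] :
    ((fun v : F × F × F => Submodule.span F {v}) '' {v | ¬ IsOnCone 4 v}).ncard
      = Nat.card F ^ 2 := by
  have hF : 1 < Nat.card F := Finite.one_lt_card
  have hc : {v : F × F × F | ¬ IsOnCone 4 v}.ncard = (Nat.card F - 1) * Nat.card F ^ 2 := by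
    have := Set.ncard_add_ncard_compl {v : F × F × F | IsOnCone 4 v}
    rw [ncard_isOnCone, Nat.card_prod, Nat.card_prod] at this
    change _ + {v : F × F × F | ¬ IsOnCone 4 v}.ncard = _ at this
    zify [hF.le] at this ⊢
    linear_combination this
  rw [Set.ncard_eq_mul_ncard_image (Set.toFinite _) (fun v : F × F × F => Submodule.span F {v})
    (Nat.card F - 1)] at hc
  · exact Nat.eq_of_mul_eq_mul_left (by omega) hc
  intro v hv
  have hv0 : v ≠ 0 := by rintro rfl; simp [IsOnCone] at hv
  have : {b ∈ {v : F × F × F | ¬ IsOnCone 4 v} | Submodule.span F {b} = Submodule.span F {v}}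
      = (fun s : F => s • v) '' {0}ᶜ := by
    ext b
    constructor
    · rintro ⟨hb, e⟩
      obtain ⟨s, rfl⟩ := Submodule.mem_span_singleton.1
        (e ▸ Submodule.mem_span_singleton_self b : b ∈ Submodule.span F {v})
      refine ⟨s, ?_, rfl⟩
      rintro rfl
      simp [IsOnCone] at hb
    · rintro ⟨s, hs, rfl⟩
      exact ⟨mt (isOnCone_smul_iff hs).1 hv, Submodule.span_singleton_smul_eq (Ne.isUnit hs) v⟩
  rw [this, Set.ncard_image_of_injective _ (smul_left_injective F hv0), Set.ncard_compl,
    Set.ncard_singleton]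

theorem range_componentInvariant [Finite F] (hF : 3 < Nat.card F) :
    Set.range (componentInvariant (F := F))
      = Sum.inl '' ((fun v : F × F × F => Submodule.span F {v}) '' {v | ¬ IsOnCone 4 v})
        ∪ Sum.inr '' (Subgroup.zpowers '' {g | IsDegenerate g ∧ g ≠ 1}) := by
  apply Set.Subset.antisymm
  · rintro _ ⟨g, rfl⟩
    by_cases hg : IsDegenerate g.1
    · rw [componentInvariant, if_pos hg]
      exact Or.inr ⟨_, ⟨g.1, ⟨hg, g.2⟩, rfl⟩, rfl⟩
    · rw [componentInvariant, if_neg hg]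
      exact Or.inl ⟨_, ⟨_, hg, rfl⟩, rfl⟩
  · rintro _ (⟨_, ⟨v, hv, rfl⟩, rfl⟩ | ⟨_, ⟨g, ⟨hg, hg1⟩, rfl⟩, rfl⟩)
    · obtain ⟨s, M, hs, e⟩ := exists_modScalar_eq_smul hF hv
      have hM : ¬ IsDegenerate (M : Matrix.ProjectiveSpecialLinearGroup (Fin 2) F) := by
        rwa [isDegenerate_mk, e, isOnCone_smul_iff hs]
      have hM1 : (M : Matrix.ProjectiveSpecialLinearGroup (Fin 2) F) ≠ 1 :=
        fun h => hM (h ▸ isDegenerate_one)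
      refine ⟨⟨M, hM1⟩, ?_⟩
      rw [componentInvariant, if_neg hM, modScalarSpan_mk, e,
        Submodule.span_singleton_smul_eq hs.isUnit]
    · exact ⟨⟨g, hg1⟩, by rw [componentInvariant, if_pos hg]⟩

end PSL

theorem mainTheorem9 (p n : ℕ) (hp : p.Prime) (hq : 3 < p ^ n)
    (F : Type*) [Field F] [Finite F] (hF : Nat.card F = p ^ n) :
    (Nat.card (properPowerGraph
        (Matrix.ProjectiveSpecialLinearGroup (Fin 2) F)).ConnectedComponent : ℚ) =
      ((p : ℚ) ^ (2 * n + 1) - 1) / ((p : ℚ) - 1) := by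
  have := Fact.mk hp
  have : CharP F p := by
    have := Fintype.ofFinite F
    exact charP_of_card_eq_prime_pow (by rw [← Nat.card_eq_fintype_card, hF])
  rw [card_connectedComponent_eq_ncard_range fun _ _ => reachable_iff_componentInvariant_eq,
    range_componentInvariant (hF ▸ hq), Set.ncard_union_eq
      (by
        rw [Set.disjoint_left]
        rintro _ ⟨_, _, rfl⟩ ⟨_, _, h⟩
        cases h),
    Set.ncard_image_of_injective _ Sum.inl_injective,
    Set.ncard_image_of_injective _ Sum.inr_injective, ncard_span_not_isOnCone]
  have h := ncard_zpowers_isDegenerate (F := F) p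
  have hp1 : (p : ℚ) - 1 ≠ 0 := sub_ne_zero.2 (by exact_mod_cast hp.one_lt.ne')
  have hle : 1 ≤ (p ^ n) ^ 2 := Nat.one_le_pow _ _ (by omega)
  rw [hF] at h ⊢
  rw [eq_div_iff hp1]
  replace h := congrArg (Nat.cast (R := ℚ)) h
  rw [Nat.cast_mul, Nat.cast_sub hp.one_le, Nat.cast_sub hle] at h
  push_cast at h ⊢
  -- After clearing p - 1: (p - 1)q² + (q² - 1) = pq² - 1.
  linear_combination h
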